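/- For a set $A$ of ordinals let $\mathrm{acc}(A)=\{\beta\in A\mid 0<\beta<\sup A,\ \sup(A\cap\beta)=\beta\}$ and $\mathrm{nacc}(A)=A\setminus\mathrm{acc}(A)$. For an infinite cardinal $\lambda$, cardinals $\kappa,\mu$ and a set $\Gamma$ of ordinals, the principle $\clubsuit\square^{\Gamma,\mu}_{\lambda,\kappa}$ asserts the existence of a sequence $\langle\mathcal C_\alpha\mid\alpha<\lambda^+\rangle$ of families of sets of ordinals such that: (1) for every nonzero limit $\alpha<\lambda^+$, $\mathcal C_\alpha$ is a nonempty collection of club subsets of $\alpha$; (2) if $C\in\mathcal C_\alpha$, then $\mathrm{otp}(C)\le\lambda$, and $C\cap\beta\in\mathcal C_\beta$ for every $\beta\in\mathrm{acc}(C)$; (3) $|\mathcal C_\alpha|\le\kappa$ for all $\alpha<\lambda^+$; (4) for every cofinal $A\subseteq\lambda^+$ and every nonzero limit ordinal $\theta\in\Gamma$ there is a nonzero limit ordinal $\alpha<\lambda^+$ such that $|\mathcal C_\alpha|\le\mu$ and, for all $C\in\mathcal C_\alpha$, $\mathrm{nacc}(C)\subseteq A$ and $\theta$ divides $\mathrm{otp}(C)$.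 A tree is a partially ordered set $T$ in which $x_\downarrow=\{y\mid y<x\}$ is well-ordered for every $x\in T$; the height of $x$ is $\mathrm{ht}(x)=\mathrm{otp}(x_\downarrow)$, and the height of $T$ is $\sup_{x\in T}\mathrm{ht}(x)$. A $\lambda^+$-Souslin tree is a tree of height $\lambda^+$ in which no subset of size $\lambda^+$ is a chain or an antichain (a set of pairwise incomparable elements). $T$ is homogeneous if $\{z\mid x<z\}\cong\{z\mid y<z\}$ whenever $\mathrm{ht}(x)=\mathrm{ht}(y)$, and $\kappa$-complete if every chain $C\subseteq T$ with $|C|<\kappa$ satisfies $C\subseteq x_\downarrow$ for some $x\in T$. **Proposition.** Let $\lambda$ be an uncountable cardinal such that $\clubsuit\square^{\{\lambda\},\lambda}_{\lambda,\lambda}$ holds and $2^\lambda=\lambda^+$. Then there exists a homogeneous $\lambda^+$-Souslin tree. Moreover, there exists one which is $\kappa$-complete, where $\kappa=\min\{\theta\ge 1\mid\lambda^\theta\ne\lambda\}$. -/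

import Mathlib

open scoped Cardinal Ordinal

universe u

namespace Souslin

/-! ### Sets of ordinals

The ordinals below `o` are represented by the well-ordered type `o.ToType`, which has order
type `o`. The auxiliary notions are defined for an arbitrary well-ordered type `W`. -/

section Sets

variable {W : Type u} [LinearOrder W] [WellFoundedLT W]

/-- The order type of a subset of a well-ordered type. -/
noncomputable def otp (C : Set W) : Ordinal.{u} :=
  Ordinal.type (fun a b : C => a < b)

/-- The accumulation points of `C` that belong to `C`: those `β ∈ C` with `β < sup C` and
`sup (C ∩ β) = β`. The set `C ∩ β` is required to be nonempty, so `0` is never an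
accumulation point. -/
def acc (C : Set W) : Set W :=
  {β | β ∈ C ∧ (∃ δ ∈ C, β < δ) ∧ (C ∩ Set.Iio β).Nonempty ∧ IsLUB (C ∩ Set.Iio β) β}

/-- The non-accumulation points of `C`. -/
def nacc (C : Set W) : Set W := C \ acc C

/-- `C` is a closed and cofinal subset of (the set of predecessors of) `α`. -/
def IsClubIn (C : Set W) (α : W) : Prop :=
  C ⊆ Set.Iio α ∧ IsClub (Subtype.val ⁻¹' C : Set (Set.Iio α))

end Sets

/-- `C` is a witness to the guessing square principle with parameters `Γ`, `μ`, `lam`, `κ`. -/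
structure IsClubSquareSeq (Γ : Set Ordinal.{u}) (μ lam κ : Cardinal.{u})
    (C : (Order.succ lam).ord.ToType → Set (Set (Order.succ lam).ord.ToType)) : Prop where
  nonempty : ∀ α, Order.IsSuccLimit α → (C α).Nonempty
  isClubIn : ∀ α, Order.IsSuccLimit α → ∀ c ∈ C α, IsClubIn c α
  otp_le : ∀ α, ∀ c ∈ C α, otp c ≤ lam.ord
  coherent : ∀ α, ∀ c ∈ C α, ∀ β ∈ acc c, c ∩ Set.Iio β ∈ C β
  card_le : ∀ α, #(C α) ≤ κ
  guess : ∀ A : Set (Order.succ lam).ord.ToType, IsCofinal A →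
    ∀ θ ∈ Γ, Order.IsSuccLimit θ →
      ∃ α, Order.IsSuccLimit α ∧ #(C α) ≤ μ ∧ (∀ c ∈ C α, nacc c ⊆ A) ∧ ∀ c ∈ C α, θ ∣ otp c

/-- The guessing square principle with upper indices `Γ`, `μ` and lower indices `lam`, `κ`. -/
def ClubSquare (Γ : Set Ordinal.{u}) (μ lam κ : Cardinal.{u}) : Prop :=
  ∃ C : (Order.succ lam).ord.ToType → Set (Set (Order.succ lam).ord.ToType),
    IsClubSquareSeq Γ μ lam κ C

/-- The local continuum hypothesis at `lam`. -/
def CH (lam : Cardinal.{u}) : Prop := (2 : Cardinal.{u}) ^ lam = Order.succ lam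

/-! ### Trees -/

/-- A tree is a partial order in which the set of predecessors of each node is well-ordered. -/
class IsTree (T : Type u) [PartialOrder T] : Prop where
  isWellOrder_Iio : ∀ x : T, IsWellOrder (Set.Iio x) (· < ·)

section Trees

variable (T : Type u) [PartialOrder T] [IsTree T]

/-- The height of a node: the order type of its set of predecessors. -/
noncomputable def nodeHeight {T : Type u} [PartialOrder T] [IsTree T] (x : T) : Ordinal.{u} :=
  haveI := IsTree.isWellOrder_Iio x
  Ordinal.type (fun a b : Set.Iio x => a < b)

/-- The height of a tree: the supremum of the heights of its nodes. -/
noncomputable def treeHeight : Ordinal.{u} := ⨆ x : T, nodeHeight x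

/-- Nodes of the same height have isomorphic cones of strict successors. -/
def IsHomogeneous : Prop :=
  ∀ x y : T, nodeHeight x = nodeHeight y → Nonempty (Set.Ioi x ≃o Set.Ioi y)

/-- Every chain of size less than `κ` has a strict upper bound. -/
def IsCompleteTree (T : Type u) [PartialOrder T] (κ : Cardinal.{u}) : Prop :=
  ∀ C : Set T, IsChain (· ≤ ·) C → #C < κ → ∃ x : T, C ⊆ Set.Iio x

/-- The tree `T` is a `μ`-Souslin tree: its height is `μ`, and no subset of size `μ` is a chain
or an antichain (a set of pairwise incomparable nodes). -/
def IsSouslinTree (μ : Cardinal.{u}) : Prop :=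
  treeHeight T = μ.ord ∧
    ∀ B : Set T, #B = μ → ¬ IsChain (· ≤ ·) B ∧ ¬ IsAntichain (· ≤ ·) B

end Trees

end Souslin

/-! Nodes of level `α` are binary sequences on `α`, padded by `false`. The levels are closed under
grafting: replacing an initial part of a node by another node of that height gives a node again
(`graft_mem_level`). Hence `r ↦ graft q r` carries the cone of `p` onto the cone of `q` when the
heights agree, which is homogeneity. Levels of cofinality less than `κ` receive every branch through
the lower levels, which gives completeness; such a level still has at most `λ` nodes because `λ ^ θ
≤ λ` for `θ < κ`. All other levels receive only the grafts of one canonical branch for each `c ∈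
club α`. The choice made by that branch at `β` depends only on `c ∩ β` and on the levels up to `β`,
so coherence of the clubs carries it through accumulation points (`branch_congr`, `isBranch_aux`).

Let `A` be a maximal antichain. By `2 ^ λ = λ⁺`, every set of at most `λ` nodes is guessed at
cofinally many levels. Hence there are cofinally many `β` whose guess is a suitable bounded piece of
`A`, and the square principle yields `α` such that every `c ∈ club α` has order type `λ` and its
non-accumulation points among these `β`. Along `c`, each node `x` below `α` gets its turn at some
step from `γ` to the next `β ∈ c`, and there the branch is extended so that its graft by `x` passes
above an element of `A` (`exists_cut_branch_eq`). By König's inequality `λ < λ ^ cof λ`, the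
cofinality of `α` is not less than `κ`, so all nodes at `α` are such grafts. Hence `A` lives below
`α` and has size at most `λ` (`exists_level_bound`). Large chains are excluded because the siblings
along one would form a large antichain. -/

namespace Souslin

/-! ### Binary sequences -/

section Graft

variable {W : Type u} [LinearOrder W]

/-- The sequence that follows `x` below `γ` and `y` from `γ` on. -/
def graft (x : W → Bool) (γ : W) (y : W → Bool) : W → Bool :=
  fun ξ => if ξ < γ then x ξ else y ξ

/-- The restriction of `x` to the ordinals below `γ`, padded by `false`. -/
def cut (x : W → Bool) (γ : W) : W → Bool := graft x γ fun _ => false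

theorem cut_apply (x : W → Bool) (γ ξ : W) : cut x γ ξ = if ξ < γ then x ξ else false := rfl

theorem cut_apply_of_lt {x : W → Bool} {γ ξ : W} (h : ξ < γ) : cut x γ ξ = x ξ := by
  simp [cut_apply, h]

theorem cut_eq_cut_iff {x y : W → Bool} {γ : W} :
    cut x γ = cut y γ ↔ ∀ ξ < γ, x ξ = y ξ := by
  constructor
  · intro h ξ hξ
    rw [← cut_apply_of_lt (x := x) hξ, h, cut_apply_of_lt hξ]
  · intro h
    funext ξ
    by_cases hξ : ξ < γ <;> simp [cut_apply, hξ, h]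

theorem cut_cut_of_le {x : W → Bool} {γ δ : W} (h : γ ≤ δ) : cut (cut x δ) γ = cut x γ :=
  cut_eq_cut_iff.2 fun _ hξ => cut_apply_of_lt (hξ.trans_le h)

theorem cut_cut_of_ge {x : W → Bool} {γ δ : W} (h : δ ≤ γ) : cut (cut x δ) γ = cut x δ := by
  funext ξ
  grind [cut_apply]

theorem cut_eq_self_of_le {x : W → Bool} {γ δ : W} (hx : cut x γ = x) (h : γ ≤ δ) :
    cut x δ = x := by
  rw [← hx, cut_cut_of_ge h]

theorem cut_graft_of_le {x y : W → Bool} {γ δ : W} (h : δ ≤ γ) :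
    cut (graft x γ y) δ = cut x δ := by
  funext ξ
  grind [cut_apply, graft]

theorem cut_graft_of_ge {x y : W → Bool} {γ δ : W} (h : γ ≤ δ) :
    cut (graft x γ y) δ = graft x γ (cut y δ) := by
  funext ξ
  grind [cut_apply, graft]

theorem graft_cut_self (x : W → Bool) (γ : W) : graft (cut x γ) γ x = x := by
  funext ξ
  grind [cut_apply, graft]

theorem graft_eq_of_cut_eq {x y : W → Bool} {γ : W} (h : cut y γ = x) : graft x γ y = y := by
  rw [← h, graft_cut_self]

theorem graft_graft_of_le {x y z : W → Bool} {γ δ : W} (h : δ ≤ γ) :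
    graft x γ (graft y δ z) = graft x γ z := by
  funext ξ
  grind [graft]

theorem graft_graft_of_ge {x y z : W → Bool} {γ δ : W} (h : γ ≤ δ) :
    graft x γ (graft y δ z) = graft (graft x γ y) δ z := by
  funext ξ
  grind [graft]

theorem graft_of_cut_eq_self {x y : W → Bool} {γ : W} (hx : cut x γ = x) (hy : cut y γ = y) :
    graft x γ y = x := by
  funext ξ
  have h₁ := congrFun hx ξ
  have h₂ := congrFun hy ξ
  grind [cut_apply, graft]

end Graft

/-! ### Well-founded recursion -/

section Recursion

variable {W : Type u} [LinearOrder W] [WellFoundedLT W] {X : Type*} [Inhabited X]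

/-- The function defined by the recursion rule `G`. -/
noncomputable def wfRec (G : (W → X) → W → X) : W → X :=
  open Classical in
  wellFounded_lt.fix fun α r => G (fun β => if h : β < α then r β h else default) α

/-- In `wfRec` the values not yet defined are padded by `default`; the hypothesis on `G` says that
the rule never looks at the padding. -/
theorem wfRec_eq {G : (W → X) → W → X}
    (hG : ∀ r r' α, (∀ β < α, r β = r' β) → G r α = G r' α) (α : W) :
    wfRec G α = G (wfRec G) α := by
  rw [wfRec, WellFounded.fix_eq]
  apply hG
  intro β hβ
  rw [dif_pos hβ]

end Recursion

/-! ### The construction -/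

/-- The parameters of the construction of a tree: a system of sets to climb along, a bound for the
cofinalities at which all branches are continued, guesses for antichains, and bookkeeping. -/
structure Plan (W L : Type u) where
  club : W → Set (Set W)
  bound : Cardinal.{u}
  guess : W → Set (W × (W → Bool))
  code : Set (W × (W → Bool)) → W × (W → Bool) → L
  book : Ordinal.{u} → Ordinal.{u} × L

section Construction

variable {W : Type u} [LinearOrder W] {L : Type u}

/-- `Iio α` has a cofinal subset of size less than `κ`. -/
def SmallCof (κ : Cardinal.{u}) (α : W) : Prop :=
  ∃ s : Set W, s ⊆ Set.Iio α ∧ #s < κ ∧ ∀ ξ < α, ∃ η ∈ s, ξ ≤ η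

/-- The nodes of height less than `ε`. -/
def nodesBelow (S : W → Set (W → Bool)) (ε : W) : Set (W × (W → Bool)) :=
  {p | p.1 < ε ∧ p.2 ∈ S p.1}

theorem nodesBelow_congr {S S' : W → Set (W → Bool)} {ε : W} (h : ∀ δ < ε, S δ = S' δ) :
    nodesBelow S ε = nodesBelow S' ε := by
  ext p
  simp only [nodesBelow, Set.mem_ofPred_eq]
  exact and_congr_right fun hp => by rw [h _ hp]

/-- The sequence that agrees with `b γ` below each `γ ∈ c ∩ β`, for a coherent family `b`. -/
noncomputable def glue (b : W → W → Bool) (c : Set W) (β : W) : W → Bool :=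
  open Classical in
  fun ξ => decide (∃ γ ∈ c ∩ Set.Iio β, ξ < γ ∧ b γ ξ = true)

theorem glue_congr {b b' : W → W → Bool} {c c' : Set W} {β : W}
    (hc : c ∩ Set.Iio β = c' ∩ Set.Iio β) (h : ∀ γ < β, b γ = b' γ) :
    glue b c β = glue b' c' β := by
  funext ξ
  unfold glue
  rw [hc]
  congr 1
  refine propext (exists_congr fun γ => and_congr_right fun hγ => ?_)
  rw [h γ hγ.2]

namespace Plan

variable [WellFoundedLT W] (D : Plan W L)

/-- The node `p` is the one that the bookkeeping attends to after the element `γ` of `c`. -/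
def Treats (S : W → Set (W → Bool)) (c : Set W) (γ : W) (p : W × (W → Bool)) : Prop :=
  ∃ ε ∈ c, ε ≤ γ ∧ p ∈ nodesBelow S ε ∧
    D.book (otp (c ∩ Set.Iio γ)) = (otp (c ∩ Set.Iio ε), D.code (nodesBelow S ε) p)

/-- `y'` extends `y` from level `γ` to level `β`, and the graft of the treated node onto it is
above a node of the guess at `β`. -/
def Seals (S : W → Set (W → Bool)) (c : Set W) (γ : W) (y : W → Bool) (β : W)
    (y' : W → Bool) : Prop :=
  (y' ∈ S β ∧ cut y' γ = y) ∧ ∃ p, D.Treats S c γ p ∧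
    ∃ a ∈ D.guess β, a.1 ≤ β ∧ cut (graft p.2 p.1 y') a.1 = a.2

open Classical in
/-- An extension of `y` from level `γ` to level `β`, if possible one that seals the guess. -/
noncomputable def next (S : W → Set (W → Bool)) (c : Set W) (γ : W) (y : W → Bool) (β : W) :
    W → Bool :=
  if ∃ y', D.Seals S c γ y β y' then Classical.epsilon (D.Seals S c γ y β)
  else Classical.epsilon fun y' => y' ∈ S β ∧ cut y' γ = y

open Classical in
/-- The recursion rule for `branch`. -/
noncomputable def branchRule (S : W → Set (W → Bool)) (c : Set W) (b : W → W → Bool) (β : W) :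
    W → Bool :=
  if h : ∃ γ, IsGreatest (c ∩ Set.Iio β) γ then D.next S c h.choose (b h.choose) β
  else if (c ∩ Set.Iio β).Nonempty then glue b c β
  else Classical.epsilon fun y => y ∈ S β

/-- The node at level `β` of the branch that climbs through the levels in `c`. -/
noncomputable def branch (S : W → Set (W → Bool)) (c : Set W) : W → W → Bool :=
  wfRec (D.branchRule S c)

/-- The recursion rule for `level`: a level consists of branches through the lower levels, all of
them if the cofinality is small, otherwise those that end in one of the canonical branches. -/
def levelRule (S : W → Set (W → Bool)) (α : W) : Set (W → Bool) :=
  {f | cut f α = f ∧ (∀ γ < α, cut f γ ∈ S γ) ∧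
    (SmallCof D.bound α ∨
      ∃ γ < α, ∃ x ∈ S γ, ∃ c ∈ D.club α, f = graft x γ (glue (D.branch S c) c α))}

/-- The levels of the tree. -/
noncomputable def level : W → Set (W → Bool) := wfRec D.levelRule

variable {D}

/-- The bookkeeping reads `c` only through its part up to `γ`: order types of initial segments
replace any global enumeration. This locality is what makes canonical branches cohere. -/
theorem Treats.congr {S S' : W → Set (W → Bool)} {c c' : Set W} {β γ : W}
    {p : W × (W → Bool)} (hγ : γ < β) (hS : ∀ δ < β, S δ = S' δ)
    (hc : c ∩ Set.Iio β = c' ∩ Set.Iio β) (h : D.Treats S c γ p) : D.Treats S' c' γ p := by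
  have key : ∀ δ ≤ γ, c ∩ Set.Iio δ = c' ∩ Set.Iio δ := by
    intro δ hδ
    have hδβ : Set.Iio β ∩ Set.Iio δ = Set.Iio δ :=
      Set.inter_eq_right.2 (Set.Iio_subset_Iio (hδ.trans hγ.le))
    rw [← hδβ, ← Set.inter_assoc, hc, Set.inter_assoc]
  obtain ⟨ε, hε, hεγ, hp, hb⟩ := h
  have hn : nodesBelow S ε = nodesBelow S' ε :=
    nodesBelow_congr fun δ hδ => hS δ (hδ.trans (hεγ.trans_lt hγ))
  have hε' : ε ∈ c' ∩ Set.Iio β := hc ▸ ⟨hε, hεγ.trans_lt hγ⟩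
  refine ⟨ε, hε'.1, hεγ, hn ▸ hp, ?_⟩
  rw [← key γ le_rfl, ← key ε hεγ, ← hn, hb]

theorem treats_congr {S S' : W → Set (W → Bool)} {c c' : Set W} {β γ : W} (hγ : γ < β)
    (hS : ∀ δ < β, S δ = S' δ) (hc : c ∩ Set.Iio β = c' ∩ Set.Iio β) :
    D.Treats S c γ = D.Treats S' c' γ :=
  funext fun _ => propext
    ⟨fun h => h.congr hγ hS hc, fun h => h.congr hγ (fun δ hδ => (hS δ hδ).symm) hc.symm⟩

theorem next_congr {S S' : W → Set (W → Bool)} {c c' : Set W} {β γ : W} (y : W → Bool)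
    (hγ : γ < β) (hS : ∀ δ ≤ β, S δ = S' δ) (hc : c ∩ Set.Iio β = c' ∩ Set.Iio β) :
    D.next S c γ y β = D.next S' c' γ y β := by
  have h : D.Seals S c γ y β = D.Seals S' c' γ y β := by
    unfold Seals
    rw [treats_congr hγ (fun δ hδ => hS δ hδ.le) hc, hS β le_rfl]
  unfold next
  rw [h, hS β le_rfl]

theorem branchRule_of_isGreatest {S : W → Set (W → Bool)} {c : Set W} {b : W → W → Bool}
    {β γ : W} (h : IsGreatest (c ∩ Set.Iio β) γ) :
    D.branchRule S c b β = D.next S c γ (b γ) β := by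
  have h' : ∃ γ, IsGreatest (c ∩ Set.Iio β) γ := ⟨γ, h⟩
  rw [branchRule, dif_pos h', h'.choose_spec.unique h]

theorem branchRule_congr {S S' : W → Set (W → Bool)} {c c' : Set W} {b b' : W → W → Bool} {β : W}
    (hS : ∀ δ ≤ β, S δ = S' δ) (hc : c ∩ Set.Iio β = c' ∩ Set.Iio β)
    (hb : ∀ γ < β, b γ = b' γ) : D.branchRule S c b β = D.branchRule S' c' b' β := by
  by_cases h : ∃ γ, IsGreatest (c ∩ Set.Iio β) γ
  · obtain ⟨γ, hγ⟩ := h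
    rw [branchRule_of_isGreatest hγ, branchRule_of_isGreatest (hc ▸ hγ), hb γ hγ.1.2,
      next_congr _ hγ.1.2 hS hc]
  · rw [branchRule, branchRule, dif_neg h, dif_neg (hc ▸ h), hc, glue_congr hc hb, hS β le_rfl]

theorem branch_eq (S : W → Set (W → Bool)) (c : Set W) (β : W) :
    D.branch S c β = D.branchRule S c (D.branch S c) β :=
  wfRec_eq (G := D.branchRule S c) (fun _ _ _ h => branchRule_congr (fun _ _ => rfl) rfl h) β

/-- Varying `S` justifies the recursion that defines `level`, where the branch is evaluated only
below `α`. Varying `c` identifies the branch along `c` with the branch along `c ∩ β` at an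
accumulation point `β`. -/
theorem branch_congr {S S' : W → Set (W → Bool)} {c c' : Set W} {β : W}
    (hS : ∀ δ ≤ β, S δ = S' δ) (hc : c ∩ Set.Iio β = c' ∩ Set.Iio β) :
    D.branch S c β = D.branch S' c' β := by
  induction β using WellFoundedLT.induction with
  | ind β ih =>
    rw [branch_eq, branch_eq]
    refine branchRule_congr hS hc fun γ hγ => ih γ hγ (fun δ hδ => hS δ (hδ.trans hγ.le)) ?_
    have hγβ : Set.Iio β ∩ Set.Iio γ = Set.Iio γ :=
      Set.inter_eq_right.2 (Set.Iio_subset_Iio hγ.le)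
    rw [← hγβ, ← Set.inter_assoc, hc, Set.inter_assoc]

theorem level_eq (α : W) : D.level α = D.levelRule D.level α := by
  refine wfRec_eq (fun S S' α h => ?_) α
  ext f
  simp only [levelRule, Set.mem_ofPred_eq]
  refine and_congr_right fun _ => and_congr (forall₂_congr fun γ hγ => by rw [h γ hγ])
    (or_congr Iff.rfl (exists_congr fun γ => and_congr_right fun hγ => ?_))
  rw [h γ hγ]
  refine exists_congr fun x => and_congr_right fun _ => exists_congr fun c =>
    and_congr_right fun _ => ?_
  rw [glue_congr rfl fun δ hδ => branch_congr (fun ε hε => h ε (hε.trans_lt hδ)) rfl]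

theorem mem_level_iff {α : W} {f : W → Bool} :
    f ∈ D.level α ↔ cut f α = f ∧ (∀ γ < α, cut f γ ∈ D.level γ) ∧
      (SmallCof D.bound α ∨ ∃ γ < α, ∃ x ∈ D.level γ, ∃ c ∈ D.club α,
        f = graft x γ (glue (D.branch D.level c) c α)) := by
  rw [level_eq]
  rfl

end Plan

end Construction

/-! ### The levels of the tree -/

section Levels

variable {W : Type u} [LinearOrder W] {L : Type u}

theorem glue_apply {b : W → W → Bool} {c : Set W} {β γ ξ : W}
    (hb : ∀ γ ∈ c, ∀ δ ∈ c, γ < δ → δ < β → cut (b δ) γ = b γ)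
    (hγ : γ ∈ c) (hγβ : γ < β) (hξ : ξ < γ) : glue b c β ξ = b γ ξ := by
  have key : ∀ δ ∈ c, δ < β → ξ < δ → b δ ξ = b γ ξ := by
    intro δ hδ hδβ hξδ
    rcases lt_trichotomy γ δ with h | rfl | h
    · rw [← hb γ hγ δ hδ h hδβ, cut_apply_of_lt hξ]
    · rfl
    · rw [← hb δ hδ γ hγ h hγβ, cut_apply_of_lt hξδ]
  rw [Bool.eq_iff_iff]
  simp only [glue, decide_eq_true_eq]
  constructor
  · rintro ⟨δ, ⟨hδ, hδβ⟩, hξδ, h⟩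
    rwa [← key δ hδ hδβ hξδ]
  · exact fun h => ⟨γ, ⟨hγ, hγβ⟩, hξ, h⟩

theorem cut_glue {b : W → W → Bool} {c : Set W} {β γ : W}
    (hb : ∀ γ ∈ c, ∀ δ ∈ c, γ < δ → δ < β → cut (b δ) γ = b γ)
    (hγ : γ ∈ c) (hγβ : γ < β) (hbγ : cut (b γ) γ = b γ) : cut (glue b c β) γ = b γ := by
  rw [← hbγ]
  exact cut_eq_cut_iff.2 fun ξ hξ => glue_apply hb hγ hγβ hξ

theorem cut_glue_self (b : W → W → Bool) (c : Set W) (β : W) :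
    cut (glue b c β) β = glue b c β := by
  funext ξ
  by_cases hξ : ξ < β
  · exact cut_apply_of_lt hξ
  · rw [cut_apply, if_neg hξ, eq_comm, glue, decide_eq_false_iff_not]
    rintro ⟨γ, ⟨-, hγ⟩, hξγ, -⟩
    exact hξ (hξγ.trans hγ)

/-- Successor levels thus fall under the clause that continues everything, so every node has both
immediate extensions. -/
theorem smallCof_of_covBy {κ : Cardinal.{u}} (hκ : 1 < κ) {γ α : W} (h : γ ⋖ α) :
    SmallCof κ α :=
  ⟨{γ}, by simpa using h.lt, by simpa using hκ, fun _ hξ => ⟨γ, rfl, h.le_of_lt hξ⟩⟩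

theorem IsClubIn.exists_gt [WellFoundedLT W] {c : Set W} {α : W} (hc : IsClubIn c α)
    (hα : Order.IsSuccLimit α) {ξ : W} (hξ : ξ < α) : ∃ γ ∈ c, ξ < γ ∧ γ < α := by
  obtain ⟨η, hξη, hηα⟩ : ∃ η, ξ < η ∧ η < α := by
    have := hα.isSuccPrelimit ξ
    rw [not_covBy_iff hξ] at this
    exact this
  obtain ⟨γ, hγ, hle⟩ := hc.2.isCofinal ⟨η, hηα⟩
  exact ⟨γ, hγ, hξη.trans_le hle, γ.2⟩

theorem isSuccLimit_of_mem_acc {c : Set W} {β : W} (h : β ∈ acc c) : Order.IsSuccLimit β := by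
  obtain ⟨-, -, ⟨γ, hγ⟩, hlub⟩ := h
  refine ⟨fun hmin => (hmin hγ.2.le).not_gt hγ.2, fun δ hδ => ?_⟩
  exact hδ.lt.not_ge (hlub.2 fun ξ hξ => hδ.le_of_lt hξ.2)

/-- If the supremum of `c ∩ β` were below `β`, closedness would put it into `c`, and it would be the
greatest element of `c ∩ β`. -/
theorem IsClubIn.mem_acc [WellFoundedLT W] {c : Set W} {α β : W} (hc : IsClubIn c α)
    (hα : Order.IsSuccLimit α) (hβ : β ∈ c) (hne : (c ∩ Set.Iio β).Nonempty)
    (hg : ¬ ∃ γ, IsGreatest (c ∩ Set.Iio β) γ) : β ∈ acc c := by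
  have hβα : β < α := hc.1 hβ
  obtain ⟨δ, hδ, hβδ, -⟩ := hc.exists_gt hα hβα
  refine ⟨hβ, ⟨δ, hδ, hβδ⟩, hne, fun ξ hξ => hξ.2.le, fun η hη => ?_⟩
  by_contra! hηβ
  have hne' : (upperBounds (c ∩ Set.Iio β)).Nonempty := ⟨η, hη⟩
  set σ := wellFounded_lt.min (upperBounds (c ∩ Set.Iio β)) hne'
  have hσ : IsLUB (c ∩ Set.Iio β) σ :=
    ⟨wellFounded_lt.min_mem _ hne', fun ζ hζ => not_lt.1 (wellFounded_lt.not_lt_min _ hζ)⟩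
  have hσβ : σ < β := (hσ.2 hη).trans_lt hηβ
  have hmem : (⟨σ, hσβ.trans hβα⟩ : Set.Iio α) ∈ (Subtype.val ⁻¹' c : Set (Set.Iio α)) := by
    refine hc.2.isLUB_mem (t := Subtype.val ⁻¹' (c ∩ Set.Iio β)) (fun x hx => hx.1) ?_ ?_
    · obtain ⟨γ, hγ⟩ := hne
      exact ⟨⟨γ, hc.1 hγ.1⟩, hγ⟩
    · exact ⟨fun x hx => hσ.1 hx, fun x hx => hσ.2 fun ξ hξ => hx (a := ⟨ξ, hc.1 hξ.1⟩) hξ⟩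
  exact hg ⟨σ, ⟨hmem, hσβ⟩, hσ.1⟩

namespace Plan

variable [WellFoundedLT W] {D : Plan W L}

variable (D) in
/-- The sets to climb along form a coherent system of clubs, and the bound is not trivial. -/
structure IsCoherent : Prop where
  one_lt_bound : 1 < D.bound
  nonempty : ∀ α, Order.IsSuccLimit α → (D.club α).Nonempty
  isClubIn : ∀ α, Order.IsSuccLimit α → ∀ c ∈ D.club α, IsClubIn c α
  coherent : ∀ α, ∀ c ∈ D.club α, ∀ β ∈ acc c, c ∩ Set.Iio β ∈ D.club β

theorem cut_self_of_mem_level {α : W} {f : W → Bool} (hf : f ∈ D.level α) : cut f α = f :=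
  (mem_level_iff.1 hf).1

theorem cut_mem_level {α γ : W} {f : W → Bool} (hf : f ∈ D.level α) (h : γ ≤ α) :
    cut f γ ∈ D.level γ := by
  rcases h.lt_or_eq with h | rfl
  · exact (mem_level_iff.1 hf).2.1 γ h
  · rwa [cut_self_of_mem_level hf]

/-- The small cofinality clause does not mention the node. For a canonical node with stem `z` of
height `δ`, grafting `x` either overwrites the whole stem (`δ ≤ γ`) or changes it to `graft x γ z`,
which is a node by induction. -/
theorem graft_mem_level {α γ : W} {x y : W → Bool} (hx : x ∈ D.level γ) (hy : y ∈ D.level α)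
    (h : γ ≤ α) : graft x γ y ∈ D.level α := by
  induction α using WellFoundedLT.induction generalizing γ x y with
  | ind α ih =>
    rcases h.lt_or_eq with h | rfl
    swap
    · rwa [graft_of_cut_eq_self (cut_self_of_mem_level hx) (cut_self_of_mem_level hy)]
    obtain ⟨hy₁, hy₂, hy₃⟩ := mem_level_iff.1 hy
    refine mem_level_iff.2 ⟨by rw [cut_graft_of_ge h.le, hy₁], fun δ hδ => ?_, ?_⟩
    · rcases le_total δ γ with hδγ | hδγ
      · rw [cut_graft_of_le hδγ]
        exact cut_mem_level hx hδγ
      · rw [cut_graft_of_ge hδγ]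
        exact ih δ hδ hx (hy₂ δ hδ) hδγ
    · refine hy₃.imp_right ?_
      rintro ⟨δ, hδ, z, hz, c, hc, rfl⟩
      rcases le_total δ γ with hδγ | hδγ
      · exact ⟨γ, h, x, hx, c, hc, graft_graft_of_le hδγ⟩
      · exact ⟨δ, hδ, _, ih δ hδ hx hz hδγ, c, hc, graft_graft_of_ge hδγ⟩

theorem IsCoherent.mem_level_of_covBy (hD : D.IsCoherent) {γ α : W} (h : γ ⋖ α) {f : W → Bool}
    (hf : cut f α = f) (hfγ : cut f γ ∈ D.level γ) : f ∈ D.level α := by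
  refine mem_level_iff.2 ⟨hf, fun δ hδ => ?_, Or.inl (smallCof_of_covBy hD.one_lt_bound h)⟩
  rw [← cut_cut_of_le (h.le_of_lt hδ)]
  exact cut_mem_level hfγ (h.le_of_lt hδ)

theorem next_spec {S : W → Set (W → Bool)} {c : Set W} {γ β : W} {y : W → Bool}
    (h : ∃ y', y' ∈ S β ∧ cut y' γ = y) :
    D.next S c γ y β ∈ S β ∧ cut (D.next S c γ y β) γ = y := by
  unfold next
  split_ifs with hs
  · exact (Classical.epsilon_spec hs).1
  · exact Classical.epsilon_spec h

theorem next_seals {S : W → Set (W → Bool)} {c : Set W} {γ β : W} {y : W → Bool}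
    (h : ∃ y', D.Seals S c γ y β y') : D.Seals S c γ y β (D.next S c γ y β) := by
  rw [next, if_pos h]
  exact Classical.epsilon_spec h

variable (D) in
/-- The canonical branch along `c` is a coherent sequence of nodes. -/
def IsBranch (c : Set W) : Prop :=
  ∀ β ∈ c, D.branch D.level c β ∈ D.level β ∧
    ∀ γ ∈ c, γ < β → cut (D.branch D.level c β) γ = D.branch D.level c γ

theorem IsBranch.cut_glue {c : Set W} (h : D.IsBranch c) {γ α : W} (hγ : γ ∈ c) (hγα : γ < α) :
    cut (glue (D.branch D.level c) c α) γ = D.branch D.level c γ :=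
  Souslin.cut_glue (fun γ hγ δ hδ hlt _ => (h δ hδ).2 γ hγ hlt) hγ hγα
    (cut_self_of_mem_level (h γ hγ).1)

/-- The assumptions `hne` and `hlim` are the induction hypotheses of `level_nonempty_aux`: a climb
needs nodes to step to, and limits of shorter climbs that are nodes. -/
theorem IsCoherent.isBranch_aux (hD : D.IsCoherent) {α : W} (hα : Order.IsSuccLimit α)
    (hne : ∀ β < α, (D.level β).Nonempty)
    (hlim : ∀ β < α, Order.IsSuccLimit β → ∀ c ∈ D.club β,
      glue (D.branch D.level c) c β ∈ D.level β) {c : Set W} (hc : c ∈ D.club α) :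
    D.IsBranch c := by
  have hclub := hD.isClubIn α hα c hc
  intro β
  induction β using WellFoundedLT.induction with
  | ind β ih =>
    intro hβ
    have hβα : β < α := hclub.1 hβ
    by_cases hg : ∃ γ, IsGreatest (c ∩ Set.Iio β) γ
    · obtain ⟨γ, hγ⟩ := hg
      rw [branch_eq, branchRule_of_isGreatest hγ]
      obtain ⟨z, hz⟩ := hne β hβα
      have hγb := (ih γ hγ.1.2 hγ.1.1).1
      have hspec := next_spec (D := D) (S := D.level) (c := c) (γ := γ) (β := β)
        (y := D.branch D.level c γ) ⟨_, graft_mem_level hγb hz (le_of_lt hγ.1.2), by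
          rw [cut_graft_of_le le_rfl, cut_self_of_mem_level hγb]⟩
      refine ⟨hspec.1, fun δ hδ hδβ => ?_⟩
      have hδγ : δ ≤ γ := hγ.2 ⟨hδ, hδβ⟩
      rw [← cut_cut_of_le hδγ, hspec.2]
      rcases hδγ.lt_or_eq with hlt | rfl
      · exact (ih γ hγ.1.2 hγ.1.1).2 δ hδ hlt
      · exact cut_self_of_mem_level hγb
    by_cases hempty : (c ∩ Set.Iio β).Nonempty
    · have hacc := hclub.mem_acc hα hβ hempty hg
      rw [branch_eq, branchRule, dif_neg hg, if_pos hempty]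
      constructor
      -- By coherence `c ∩ β` is one of the clubs at `β`, and its canonical branch has the same
      -- limit at `β` as the one along `c`.
      · have hmem := hlim β hβα (isSuccLimit_of_mem_acc hacc) _ (hD.coherent α c hc β hacc)
        have hcc : c ∩ Set.Iio β ∩ Set.Iio β = c ∩ Set.Iio β := by
          rw [Set.inter_assoc, Set.inter_self]
        rwa [glue_congr hcc fun γ hγ => branch_congr (fun _ _ => rfl) (c' := c) (by
          rw [Set.inter_assoc, Set.inter_eq_right.2 (Set.Iio_subset_Iio hγ.le)])] at hmem
      · intro γ hγ hγβ
        exact Souslin.cut_glue (fun γ hγ δ hδ hlt hδβ => (ih δ hδβ hδ).2 γ hγ hlt) hγ hγβ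
          (cut_self_of_mem_level (ih γ hγβ hγ).1)
    · rw [branch_eq, branchRule, dif_neg hg, if_neg hempty]
      exact ⟨Classical.epsilon_spec (hne β hβα), fun γ hγ hγβ => (hempty ⟨γ, hγ, hγβ⟩).elim⟩

theorem IsCoherent.glue_mem_level_aux (hD : D.IsCoherent) {α : W} (hα : Order.IsSuccLimit α)
    {c : Set W} (hc : c ∈ D.club α) (hb : D.IsBranch c) :
    glue (D.branch D.level c) c α ∈ D.level α := by
  have hclub := hD.isClubIn α hα c hc
  have hcut : ∀ γ < α, cut (glue (D.branch D.level c) c α) γ ∈ D.level γ := by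
    intro γ hγ
    obtain ⟨δ, hδ, hγδ, hδα⟩ := hclub.exists_gt hα hγ
    rw [← cut_cut_of_le hγδ.le, hb.cut_glue hδ hδα]
    exact cut_mem_level (hb δ hδ).1 hγδ.le
  refine mem_level_iff.2 ⟨cut_glue_self _ _ _, hcut, Or.inr ?_⟩
  obtain ⟨γ, hγ⟩ := not_isMin_iff.1 hα.not_isMin
  exact ⟨γ, hγ, _, hcut γ hγ, c, hc, (graft_cut_self _ _).symm⟩

/-- Both parts need a joint induction: branches can climb because lower levels are nonempty, and
limit levels are nonempty because they contain limits of branches. -/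
theorem IsCoherent.level_nonempty_aux (hD : D.IsCoherent) (α : W) :
    (D.level α).Nonempty ∧ (Order.IsSuccLimit α → ∀ c ∈ D.club α,
      glue (D.branch D.level c) c α ∈ D.level α) := by
  induction α using WellFoundedLT.induction with
  | ind α ih =>
    have hlim : Order.IsSuccLimit α → ∀ c ∈ D.club α,
        glue (D.branch D.level c) c α ∈ D.level α := fun hα c hc =>
      hD.glue_mem_level_aux hα hc
        (hD.isBranch_aux hα (fun β hβ => (ih β hβ).1) (fun β hβ => (ih β hβ).2) hc)
    refine ⟨?_, hlim⟩
    by_cases hα : Order.IsSuccLimit α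
    · obtain ⟨c, hc⟩ := hD.nonempty α hα
      exact ⟨_, hlim hα c hc⟩
    rw [Order.not_isSuccLimit_iff, Order.not_isSuccPrelimit_iff] at hα
    rcases hα with hmin | ⟨γ, hγ⟩
    · refine ⟨fun _ => false, mem_level_iff.2 ⟨?_, fun γ hγ => (hmin.not_lt hγ).elim, Or.inl
        ⟨∅, Set.empty_subset _, ?_, fun ξ hξ => (hmin.not_lt hξ).elim⟩⟩⟩
      · funext ξ
        simp [cut_apply]
      · rw [Cardinal.mk_eq_zero]
        exact zero_lt_one.trans hD.one_lt_bound
    · obtain ⟨f, hf⟩ := (ih γ hγ.lt).1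
      have hfγ := cut_self_of_mem_level hf
      exact ⟨f, hD.mem_level_of_covBy hγ (cut_eq_self_of_le hfγ hγ.le) (by rwa [hfγ])⟩

theorem IsCoherent.level_nonempty (hD : D.IsCoherent) (α : W) : (D.level α).Nonempty :=
  (hD.level_nonempty_aux α).1

theorem IsCoherent.isBranch (hD : D.IsCoherent) {α : W} (hα : Order.IsSuccLimit α) {c : Set W}
    (hc : c ∈ D.club α) : D.IsBranch c :=
  hD.isBranch_aux hα (fun β _ => hD.level_nonempty β)
    (fun β _ => (hD.level_nonempty_aux β).2) hc

theorem IsCoherent.exists_extension (hD : D.IsCoherent) {γ α : W} (h : γ ≤ α) {x : W → Bool}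
    (hx : x ∈ D.level γ) : ∃ y ∈ D.level α, cut y γ = x := by
  obtain ⟨z, hz⟩ := hD.level_nonempty α
  exact ⟨_, graft_mem_level hx hz h, by
    rw [cut_graft_of_le le_rfl, cut_self_of_mem_level hx]⟩

end Plan

end Levels

/-! ### The tree -/

section Tree

variable {W : Type u} [LinearOrder W] {L : Type u}

theorem mk_sigma_le {lam : Cardinal.{u}} (hlam : ℵ₀ ≤ lam) {ι : Type u} {X : ι → Type u}
    (hι : #ι ≤ lam) (hX : ∀ i, #(X i) ≤ lam) : #(Σ i, X i) ≤ lam := by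
  rw [Cardinal.mk_sigma]
  calc Cardinal.sum (fun i => #(X i)) ≤ Cardinal.sum fun _ : ι => lam := Cardinal.sum_le_sum _ _ hX
    _ = #ι * lam := Cardinal.sum_const' _ _
    _ ≤ lam * lam := by gcongr
    _ = lam := Cardinal.mul_eq_self hlam

theorem mk_nodesBelow_le {lam : Cardinal.{u}} (hlam : ℵ₀ ≤ lam) (hW : ∀ α : W, #(Set.Iio α) ≤ lam)
    {S : W → Set (W → Bool)} {ε : W} (hS : ∀ δ < ε, #(S δ) ≤ lam) :
    #(nodesBelow S ε) ≤ lam := by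
  let F : (Σ δ : Set.Iio ε, S δ) → W × (W → Bool) := fun q => (q.1, q.2)
  have hsub : nodesBelow S ε ⊆ Set.range F := fun p hp => ⟨⟨⟨p.1, hp.1⟩, ⟨p.2, hp.2⟩⟩, rfl⟩
  exact (Cardinal.mk_le_mk_of_subset hsub).trans <| Cardinal.mk_range_le.trans <|
    mk_sigma_le hlam (hW ε) fun δ => hS δ δ.2

namespace Plan

variable [WellFoundedLT W]

/-- A node at small cofinality is coded by its restrictions along a short cofinal set, any other
node by a stem and a club. -/
theorem mk_level_le {D : Plan W L} {lam : Cardinal.{u}} (hlam : ℵ₀ ≤ lam)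
    (hW : ∀ α : W, #(Set.Iio α) ≤ lam) (hclub : ∀ α, #(D.club α) ≤ lam)
    (hbound : ∀ θ < D.bound, lam ^ θ ≤ lam) (α : W) : #(D.level α) ≤ lam := by
  induction α using WellFoundedLT.induction with
  | ind α ih =>
    by_cases hsmall : SmallCof D.bound α
    · obtain ⟨s, hsα, hs, hcof⟩ := hsmall
      -- The extra bit `f η` matters when `η` is the immediate predecessor of `α`: the restriction
      -- to `η` forgets it.
      let F : D.level α → ∀ η : s, D.level η.1 × Bool := fun f η =>
        (⟨cut f.1 η, cut_mem_level f.2 (le_of_lt (hsα η.2))⟩, f.1 η)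
      have hF : Function.Injective F := by
        intro f g hfg
        have hfg' : ∀ η : s, cut f.1 η = cut g.1 η ∧ f.1 η = g.1 η := fun η => by
          have := congrFun hfg η
          simpa [F] using this
        ext1
        rw [← cut_self_of_mem_level f.2, ← cut_self_of_mem_level g.2]
        refine cut_eq_cut_iff.2 fun ξ hξ => ?_
        obtain ⟨η, hη, hle⟩ := hcof ξ hξ
        rcases hle.lt_or_eq with hlt | rfl
        · exact cut_eq_cut_iff.1 (hfg' ⟨η, hη⟩).1 ξ hlt
        · exact (hfg' ⟨ξ, hη⟩).2
      refine (Cardinal.mk_le_of_injective hF).trans ?_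
      rw [Cardinal.mk_pi]
      calc Cardinal.prod (fun η : s => #(D.level η.1 × Bool))
          ≤ Cardinal.prod fun _ : s => lam := by
            refine Cardinal.prod_le_prod _ _ fun η => ?_
            rw [Cardinal.mk_prod, Cardinal.lift_uzero, Cardinal.mk_bool]
            refine (mul_le_mul' (ih η (hsα η.2)) ?_).trans (Cardinal.mul_eq_self hlam).le
            simpa using (Cardinal.natCast_lt_aleph0 (n := 2)).le.trans hlam
        _ = lam ^ #s := Cardinal.prod_const' _ _
        _ ≤ lam := hbound _ hs
    · let F : (Σ γ : Set.Iio α, D.level γ) × D.club α → W → Bool := fun q =>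
        graft q.1.2 q.1.1 (glue (D.branch D.level q.2) q.2 α)
      have hsub : D.level α ⊆ Set.range F := by
        intro f hf
        obtain ⟨-, -, h⟩ := mem_level_iff.1 hf
        obtain ⟨γ, hγ, x, hx, c, hc, rfl⟩ := h.resolve_left hsmall
        exact ⟨(⟨⟨γ, hγ⟩, ⟨x, hx⟩⟩, ⟨c, hc⟩), rfl⟩
      refine (Cardinal.mk_le_mk_of_subset hsub).trans (Cardinal.mk_range_le.trans ?_)
      rw [Cardinal.mk_prod, Cardinal.lift_id, Cardinal.lift_id]
      exact (mul_le_mul' (mk_sigma_le hlam (hW α) fun γ => ih γ γ.2) (hclub α)).trans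
        (Cardinal.mul_eq_self hlam).le

variable (D : Plan W L)

/-- The tree whose nodes at level `α` are the elements of `D.level α`. -/
@[ext]
structure Tree : Type u where
  level : W
  seq : W → Bool
  mem : seq ∈ D.level level

variable {D}

instance : PartialOrder D.Tree where
  le p q := p.level ≤ q.level ∧ cut q.seq p.level = p.seq
  le_refl p := ⟨le_rfl, cut_self_of_mem_level p.mem⟩
  le_trans p q r hpq hqr := ⟨hpq.1.trans hqr.1, by
    rw [← hpq.2, ← hqr.2, cut_cut_of_le hpq.1]⟩
  le_antisymm p q hpq hqp := by
    have h : p.level = q.level := hpq.1.antisymm hqp.1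
    refine Tree.ext h ?_
    rw [← hpq.2, h, cut_self_of_mem_level q.mem]

namespace Tree

theorem le_iff {p q : D.Tree} : p ≤ q ↔ p.level ≤ q.level ∧ cut q.seq p.level = p.seq := Iff.rfl

theorem lt_iff {p q : D.Tree} : p < q ↔ p.level < q.level ∧ cut q.seq p.level = p.seq := by
  rw [lt_iff_le_not_ge, le_iff, le_iff]
  constructor
  · rintro ⟨⟨h₁, h₂⟩, h₃⟩
    refine ⟨lt_of_not_ge fun h => h₃ ⟨h, ?_⟩, h₂⟩
    have h' : p.level = q.level := h₁.antisymm h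
    rw [← h₂, h', cut_cut_of_le le_rfl, cut_self_of_mem_level q.mem]
  · rintro ⟨h₁, h₂⟩
    exact ⟨⟨h₁.le, h₂⟩, fun h => h.1.not_gt h₁⟩

/-- The predecessors of a node correspond to the smaller levels. -/
def iioIso (p : D.Tree) : Set.Iio p ≃o Set.Iio p.level where
  toFun q := ⟨q.1.level, (lt_iff.1 q.2).1⟩
  invFun γ := ⟨⟨γ.1, cut p.seq γ, cut_mem_level p.mem (le_of_lt γ.2)⟩, lt_iff.2 ⟨γ.2, rfl⟩⟩
  left_inv q := Subtype.ext (Tree.ext rfl (lt_iff.1 q.2).2)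
  right_inv γ := rfl
  map_rel_iff' {q r} := by
    refine ⟨fun h => ⟨h, ?_⟩, fun h => h.1⟩
    change q.1.level ≤ r.1.level at h
    rw [← (lt_iff.1 r.2).2, ← (lt_iff.1 q.2).2, cut_cut_of_le h]

instance : IsTree D.Tree where
  isWellOrder_Iio p := (iioIso p).toRelIsoLT.toRelEmbedding.isWellOrder

theorem nodeHeight_eq (p : D.Tree) : nodeHeight p = Ordinal.typein (α := W) (· < ·) p.level := by
  have := IsTree.isWellOrder_Iio p
  exact Ordinal.type_eq.2 ⟨(iioIso p).toRelIsoLT⟩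

/-- Grafting `q` onto the nodes above `p` is inverted by grafting `p` back. -/
theorem isHomogeneous : IsHomogeneous D.Tree := by
  intro p q hpq
  rw [nodeHeight_eq, nodeHeight_eq, Ordinal.typein_inj] at hpq
  have key : ∀ p q : D.Tree, p.level = q.level → ∀ r : D.Tree, p < r →
      graft q.seq q.level r.seq ∈ D.level r.level ∧ cut (graft q.seq q.level r.seq) q.level = q.seq :=
    fun p q hpq r hr => ⟨graft_mem_level q.mem r.mem (hpq ▸ (lt_iff.1 hr).1.le), by
      rw [cut_graft_of_le le_rfl, cut_self_of_mem_level q.mem]⟩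
  let F : ∀ p q : D.Tree, p.level = q.level → Set.Ioi p → Set.Ioi q := fun p q hpq r =>
    ⟨⟨r.1.level, graft q.seq q.level r.1.seq, (key p q hpq r.1 r.2).1⟩,
      lt_iff.2 ⟨hpq.symm.trans_lt (lt_iff.1 r.2).1, (key p q hpq r.1 r.2).2⟩⟩
  have hF : ∀ p q (h : p.level = q.level) r, F q p h.symm (F p q h r) = r := by
    intro p q h r
    refine Subtype.ext (Tree.ext rfl ?_)
    change graft p.seq p.level (graft q.seq q.level r.1.seq) = r.1.seq
    rw [h, graft_graft_of_le le_rfl, ← h, graft_eq_of_cut_eq (lt_iff.1 r.2).2]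
  have hmono : ∀ p q (h : p.level = q.level) r r', r ≤ r' → F p q h r ≤ F p q h r' := by
    intro p q h r r' hr
    refine ⟨hr.1, ?_⟩
    change cut (graft q.seq q.level r'.1.seq) r.1.level = graft q.seq q.level r.1.seq
    rw [cut_graft_of_ge (h ▸ (lt_iff.1 r.2).1.le)]
    exact congrArg _ hr.2
  exact ⟨{ toFun := F p q hpq
           invFun := F q p hpq.symm
           left_inv := hF p q hpq
           right_inv := hF q p hpq.symm
           map_rel_iff' := fun {r r'} => ⟨fun h => by
             have := hmono q p hpq.symm _ _ h
             rwa [Equiv.coe_fn_mk, hF p q hpq, hF p q hpq] at this, hmono p q hpq r r'⟩ }⟩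

/-- Let `α` be the least strict upper bound of the levels of the chain. These levels witness that
`α` has small cofinality, so the union `f` of the chain is a node at `α`. -/
theorem isCompleteTree (hbdd : ∀ s : Set W, #s < D.bound → ∃ β, ∀ ξ ∈ s, ξ < β) :
    IsCompleteTree D.Tree D.bound := by
  classical
  intro C hC hcard
  let s : Set W := (fun t : D.Tree => t.level) '' C
  have hs : #s < D.bound := Cardinal.mk_image_le.trans_lt hcard
  have hne : {β | ∀ ξ ∈ s, ξ < β}.Nonempty := hbdd s hs
  set α := wellFounded_lt.min _ hne
  have hα : ∀ ξ ∈ s, ξ < α := wellFounded_lt.min_mem _ hne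
  have hcof : ∀ ξ < α, ∃ t ∈ C, ξ ≤ t.level := by
    intro ξ hξ
    by_contra! h
    refine wellFounded_lt.not_lt_min {β | ∀ ξ ∈ s, ξ < β} (x := ξ) ?_ hξ
    rintro _ ⟨t, ht, rfl⟩
    exact h t ht
  let f : W → Bool := fun ξ => decide (∃ t ∈ C, ξ < t.level ∧ t.seq ξ = true)
  have hf : ∀ t ∈ C, cut f t.level = t.seq := by
    intro t ht
    rw [← cut_self_of_mem_level t.mem]
    refine cut_eq_cut_iff.2 fun ξ hξ => ?_
    rw [Bool.eq_iff_iff]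
    simp only [f, decide_eq_true_eq]
    refine ⟨?_, fun h => ⟨t, ht, hξ, h⟩⟩
    rintro ⟨t', ht', hξ', h⟩
    rcases hC.total ht ht' with hle | hle
    · rwa [← hle.2, cut_apply_of_lt hξ]
    · rwa [← hle.2, cut_apply_of_lt hξ'] at h
  have hmem : f ∈ D.level α := by
    refine mem_level_iff.2 ⟨?_, fun γ hγ => ?_, Or.inl ⟨s, hα, hs, fun ξ hξ => ?_⟩⟩
    · funext ξ
      by_cases hξ : ξ < α
      · exact cut_apply_of_lt hξ
      · rw [cut_apply, if_neg hξ, eq_comm, decide_eq_false_iff_not]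
        rintro ⟨t, ht, hlt, -⟩
        exact hξ (hlt.trans (hα _ ⟨t, ht, rfl⟩))
    · obtain ⟨t, ht, hle⟩ := hcof γ hγ
      rw [← cut_cut_of_le hle, hf t ht]
      exact cut_mem_level t.mem hle
    · obtain ⟨t, ht, hle⟩ := hcof ξ hξ
      exact ⟨_, ⟨t, ht, rfl⟩, hle⟩
  exact ⟨⟨α, f, hmem⟩, fun t ht => lt_iff.2 ⟨hα _ ⟨t, ht, rfl⟩, hf t ht⟩⟩

theorem treeHeight_eq (hD : D.IsCoherent) [NoMaxOrder W] :
    treeHeight D.Tree = Ordinal.type (α := W) (· < ·) := by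
  have hbdd : BddAbove (Set.range fun x : D.Tree => nodeHeight x) := Ordinal.bddAbove_of_small
  apply le_antisymm
  · refine Ordinal.iSup_le fun x => ?_
    rw [nodeHeight_eq]
    exact (Ordinal.typein_lt_type (α := W) (· < ·) _).le
  · refine le_of_forall_lt fun o ho => ?_
    obtain ⟨α, rfl⟩ := Ordinal.typein_surj (α := W) (· < ·) ho
    obtain ⟨β, hβ⟩ := exists_gt α
    obtain ⟨f, hf⟩ := hD.level_nonempty β
    refine lt_of_lt_of_le ?_ (le_ciSup hbdd (⟨β, f, hf⟩ : D.Tree))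
    rw [nodeHeight_eq]
    exact (Ordinal.typein_lt_typein _).2 hβ

/-- A chain of full size determines a branch `F` through all levels. The node `sib ξ`, of height `ξ
+ 1`, leaves `F` exactly at `ξ`, and these nodes are pairwise incomparable. -/
theorem not_isChain_of_forall_not_isAntichain (hD : D.IsCoherent) [NoMaxOrder W]
    (hW : ∀ α : W, #(Set.Iio α) < #W)
    (hA : ∀ B : Set D.Tree, #B = #W → ¬ IsAntichain (· ≤ ·) B) {B : Set D.Tree} (hB : #B = #W) :
    ¬ IsChain (· ≤ ·) B := by
  classical
  intro hchain
  have hinj : Set.InjOn Tree.level B := by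
    intro t ht t' ht' h
    have key : ∀ t t' : D.Tree, t.level = t'.level → t ≤ t' → t = t' := fun t t' h hle =>
      hle.antisymm ⟨h.ge, by
        rw [← hle.2, h, cut_cut_of_le le_rfl, cut_self_of_mem_level t'.mem]⟩
    rcases hchain.total ht ht' with hle | hle
    · exact key t t' h hle
    · exact (key t' t h.symm hle).symm
  have hunb : ∀ ξ : W, ∃ t ∈ B, ξ < t.level := by
    intro ξ
    by_contra! h
    obtain ⟨ζ, hζ⟩ := exists_gt ξ
    have hsub : Tree.level '' B ⊆ Set.Iio ζ := by
      rintro _ ⟨t, ht, rfl⟩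
      exact (h t ht).trans_lt hζ
    have := Cardinal.mk_le_mk_of_subset hsub
    rw [Cardinal.mk_image_eq_of_injOn _ _ hinj, hB] at this
    exact this.not_gt (hW ζ)
  choose top htop hlt using hunb
  let F : W → Bool := fun ξ => (top ξ).seq ξ
  have hF : ∀ ξ, cut F ξ = cut (top ξ).seq ξ := by
    intro ξ
    refine cut_eq_cut_iff.2 fun η hη => ?_
    change (top η).seq η = (top ξ).seq η
    rcases hchain.total (htop η) (htop ξ) with hle | hle
    · rw [← hle.2, cut_apply_of_lt (hlt η)]
    · rw [← hle.2, cut_apply_of_lt (hη.trans (hlt ξ))]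
  choose σ hσ using fun ξ : W => exists_covBy_of_wellFoundedLT (not_isMax ξ)
  let sib : W → D.Tree := fun ξ => ⟨σ ξ, graft F ξ fun η => decide (η = ξ) && !F ξ, by
    refine hD.mem_level_of_covBy (hσ ξ) ?_ ?_
    · funext η
      rw [cut_apply]
      split_ifs with h
      · rfl
      · have : ξ < η := (hσ ξ).lt.trans_le (not_lt.1 h)
        simp [graft, this.not_gt, this.ne']
    · rw [cut_graft_of_le le_rfl, hF]
      exact cut_mem_level (top ξ).mem (hlt ξ).le⟩
  have hsib : ∀ ξ η, ξ ≠ η → ¬ sib ξ ≤ sib η := by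
    intro ξ η hne hle
    rcases hne.lt_or_gt with h | h
    · have h₁ := congrFun hle.2 ξ
      have h₂ : cut (sib η).seq (sib ξ).level ξ = F ξ := by
        rw [cut_apply_of_lt (hσ ξ).lt]
        simp [sib, graft, h]
      have h₃ : (sib ξ).seq ξ = !F ξ := by simp [sib, graft]
      rw [h₂, h₃] at h₁
      simp at h₁
    · exact ((hσ ξ).lt.trans_le hle.1).not_ge ((hσ η).ge_of_gt h)
  refine hA (Set.range sib) (Cardinal.mk_range_eq _ fun ξ η h => ?_) ?_
  · by_contra hne
    exact hsib ξ η hne h.le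
  · rintro _ ⟨ξ, rfl⟩ _ ⟨η, rfl⟩ hne
    exact hsib ξ η fun h => hne (h ▸ rfl)

end Tree

end Plan

end Tree

/-! ### Order types of sets of ordinals -/

section OrderTypes

variable {W : Type u} [LinearOrder W]

theorem mem_nacc_of_isGreatest {c : Set W} {β γ : W} (hβ : β ∈ c)
    (h : IsGreatest (c ∩ Set.Iio β) γ) : β ∈ nacc c :=
  ⟨hβ, fun hacc => (hacc.2.2.2.2 h.2).not_gt h.1.2⟩

variable [WellFoundedLT W]

theorem otp_inter_Iio {c : Set W} {γ : W} (hγ : γ ∈ c) :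
    otp (c ∩ Set.Iio γ) = Ordinal.typein (α := c) (· < ·) ⟨γ, hγ⟩ :=
  Ordinal.type_eq.2 ⟨{
    toFun := fun x => ⟨⟨x.1, x.2.1⟩, x.2.2⟩
    invFun := fun y => ⟨y.1.1, y.1.2, y.2⟩
    left_inv := fun _ => rfl
    right_inv := fun _ => rfl
    map_rel_iff' := Iff.rfl }⟩

theorem otp_inter_Iio_lt {c : Set W} {γ : W} (hγ : γ ∈ c) : otp (c ∩ Set.Iio γ) < otp c := by
  rw [otp_inter_Iio hγ]
  exact Ordinal.typein_lt_type _ _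

theorem otp_inter_Iio_le_iff {c : Set W} {γ δ : W} (hγ : γ ∈ c) (hδ : δ ∈ c) :
    otp (c ∩ Set.Iio γ) ≤ otp (c ∩ Set.Iio δ) ↔ γ ≤ δ := by
  rw [otp_inter_Iio hγ, otp_inter_Iio hδ, ← not_lt, Ordinal.typein_lt_typein, ← not_lt]
  rfl

theorem otp_inter_Iio_injOn (c : Set W) : Set.InjOn (fun γ => otp (c ∩ Set.Iio γ)) c :=
  fun _ hγ _ hδ h => le_antisymm ((otp_inter_Iio_le_iff hγ hδ).1 h.le)
    ((otp_inter_Iio_le_iff hδ hγ).1 h.ge)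

theorem exists_otp_inter_Iio_eq {c : Set W} {i : Ordinal.{u}} (hi : i < otp c) :
    ∃ γ ∈ c, otp (c ∩ Set.Iio γ) = i := by
  obtain ⟨γ, rfl⟩ := Ordinal.typein_surj (α := c) (· < ·) hi
  exact ⟨γ.1, γ.2, otp_inter_Iio γ.2⟩

/-- Between an element of `range u` and the earlier elements of `range u` there is no room for a
set whose non-accumulation points are in `range u`. -/
theorem le_of_nacc_subset_range {u g : W → W} (hu : StrictMono u) (hg : ∀ ξ, ∀ η < ξ, u η ≤ g ξ)
    {c : Set W} (hc : nacc c ⊆ Set.range u) {ξ γ : W} (hγ : γ ∈ c) (hγξ : γ < u ξ) :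
    γ ≤ g ξ := by
  induction γ using WellFoundedLT.induction with
  | ind γ ih =>
    by_cases hacc : γ ∈ acc c
    -- An accumulation point is the supremum of smaller elements of `c`, all bounded by `g ξ` by
    -- induction.
    · exact hacc.2.2.2.2 fun δ hδ => ih δ hδ.2 hδ.1 (lt_trans hδ.2 hγξ)
    · obtain ⟨η, rfl⟩ := hc ⟨hγ, hacc⟩
      exact hg ξ η (hu.lt_iff_lt.1 hγξ)

/-- Iterating a progressive map along a well-order. -/
theorem exists_strictMono_iterate {lam : Cardinal.{u}} (hW : ∀ α : W, #(Set.Iio α) ≤ lam)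
    (hbdd : ∀ s : Set W, #s ≤ lam → BddAbove s) {n : W → W} (hn : ∀ γ, γ < n γ) :
    ∃ u g : W → W, StrictMono u ∧ (∀ ξ, u ξ = n (g ξ)) ∧ ∀ ξ, ∀ η < ξ, u η ≤ g ξ := by
  rcases isEmpty_or_nonempty W with hemp | hne
  · exact ⟨id, id, strictMono_id, fun ξ => hemp.elim ξ, fun ξ => hemp.elim ξ⟩
  inhabit W
  choose b hb using fun s : {s : Set W // #s ≤ lam} => hbdd s.1 s.2
  have hcard : ∀ (r : W → W) (ξ : W), #(r '' Set.Iio ξ) ≤ lam := fun r ξ =>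
    Cardinal.mk_image_le.trans (hW ξ)
  let u : W → W := wfRec fun r ξ => n (b ⟨r '' Set.Iio ξ, hcard r ξ⟩)
  have hu : ∀ ξ, u ξ = n (b ⟨u '' Set.Iio ξ, hcard u ξ⟩) := by
    refine wfRec_eq fun r q ξ h => ?_
    have : r '' Set.Iio ξ = q '' Set.Iio ξ := Set.image_congr h
    simp only [this]
  have hg : ∀ ξ, ∀ η < ξ, u η ≤ b ⟨u '' Set.Iio ξ, hcard u ξ⟩ := fun ξ η hη =>
    hb ⟨u '' Set.Iio ξ, hcard u ξ⟩ ⟨η, hη, rfl⟩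
  refine ⟨u, _, fun η ξ h => ?_, hu, hg⟩
  exact (hg ξ η h).trans_lt ((hn _).trans_eq (hu ξ).symm)

end OrderTypes

/-! ### Antichains -/

section Antichains

namespace Plan

variable {W : Type u} [LinearOrder W] [WellFoundedLT W] {L : Type u} {D : Plan W L}

/-- The first coordinate of the bookkeeping value determines `ε` as an element of `c`, the second
determines the node below `ε`. So the existential in `Seals` concerns a single node. -/
theorem Treats.eq {c : Set W} {γ : W} {p q : W × (W → Bool)}
    (hcode : ∀ ε, Set.InjOn (D.code (nodesBelow D.level ε)) (nodesBelow D.level ε))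
    (hp : D.Treats D.level c γ p) (hq : D.Treats D.level c γ q) : p = q := by
  obtain ⟨ε, hε, -, hpε, hp⟩ := hp
  obtain ⟨ε', hε', -, hqε', hq⟩ := hq
  rw [hp, Prod.mk.injEq] at hq
  obtain rfl := otp_inter_Iio_injOn c hε hε' hq.1
  exact hcode ε hpε hqε' hq.2

/-- Every node below `α` is treated at some stage of the climb along a set of full order type. -/
theorem exists_treats {lam : Cardinal.{u}}
    (hbook : ∀ j < lam.ord, ∀ k : L, ∃ i, j ≤ i ∧ i < lam.ord ∧ D.book i = (j, k))
    {c : Set W} (hc : otp c = lam.ord) {p : W × (W → Bool)} (hp : p.2 ∈ D.level p.1)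
    {ε : W} (hε : ε ∈ c) (hpε : p.1 < ε) : ∃ γ ∈ c, p.1 < γ ∧ D.Treats D.level c γ p := by
  -- The node is attended to after the `i`-th element of `c`, which exists because `c` has full
  -- order type and is at least `ε` because `j ≤ i`.
  obtain ⟨i, hji, hi, hbi⟩ := hbook (otp (c ∩ Set.Iio ε)) (hc ▸ otp_inter_Iio_lt hε)
    (D.code (nodesBelow D.level ε) p)
  rw [← hc] at hi
  obtain ⟨γ, hγ, rfl⟩ := exists_otp_inter_Iio_eq hi
  have hεγ := (otp_inter_Iio_le_iff hε hγ).1 hji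
  exact ⟨γ, hγ, hpε.trans_le hεγ, ε, hε, hεγ, ⟨hpε, hp⟩, hbi⟩

/-- The guess at `β` catches an element of `A` comparable with any given node of level at most
`γ`. -/
def Catches (A : Set D.Tree) (γ β : W) : Prop :=
  (∀ p ∈ D.guess β, p.1 ≤ β ∧ ∃ a ∈ A, (a.level, a.seq) = p) ∧
    ∀ t : D.Tree, t.level ≤ γ → ∃ a ∈ A, (t ≤ a ∨ a ≤ t) ∧ (a.level, a.seq) ∈ D.guess β

theorem mk_tree_level_lt_le {lam : Cardinal.{u}} (hlam : ℵ₀ ≤ lam)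
    (hW : ∀ α : W, #(Set.Iio α) ≤ lam) (hlev : ∀ α, #(D.level α) ≤ lam) (ε : W) :
    #{t : D.Tree | t.level < ε} ≤ lam := by
  refine le_trans ?_ (mk_nodesBelow_le hlam hW (ε := ε) fun δ _ => hlev δ)
  refine Cardinal.mk_le_of_injective
    (f := fun t => ⟨(t.1.level, t.1.seq), t.2, t.1.mem⟩) fun t t' h => ?_
  have h' := congrArg Subtype.val h
  exact Subtype.ext (Tree.ext (congrArg Prod.fst h') (congrArg Prod.snd h'))

/-- There are at most `lam` nodes of level at most `γ`, so elements of `A` comparable with them can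
be picked below one level `δ'`. The part of `A` below `δ'` has size at most `lam`, so it is guessed
at some `β` beyond both `γ` and `δ'`. -/
theorem exists_catches [NoMaxOrder W] {lam : Cardinal.{u}} (hlam : ℵ₀ ≤ lam)
    (hW : ∀ α : W, #(Set.Iio α) ≤ lam) (hbdd : ∀ s : Set W, #s ≤ lam → BddAbove s)
    (hlev : ∀ α, #(D.level α) ≤ lam)
    (hguess : ∀ s : Set (W × (W → Bool)), (∀ p ∈ s, cut p.2 p.1 = p.2) → #s ≤ lam →
      ∀ ξ, ∃ β > ξ, D.guess β = s)
    {A : Set D.Tree} (hA : ∀ t, ∃ a ∈ A, t ≤ a ∨ a ≤ t) (γ : W) : ∃ β > γ, Catches A γ β := by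
  choose f hfA hf using hA
  obtain ⟨ε, hε⟩ := exists_gt γ
  obtain ⟨δ, hδ⟩ := hbdd ((fun t => (f t).level) '' {t : D.Tree | t.level < ε})
    (Cardinal.mk_image_le.trans (mk_tree_level_lt_le hlam hW hlev ε))
  obtain ⟨δ', hδ'⟩ := exists_gt δ
  obtain ⟨β, hβ, hβs⟩ := hguess ((fun a : D.Tree => (a.level, a.seq)) '' {a ∈ A | a.level < δ'})
    (by rintro _ ⟨a, -, rfl⟩; exact cut_self_of_mem_level a.mem)
    (Cardinal.mk_image_le.trans ((Cardinal.mk_le_mk_of_subset fun a ha => ha.2).trans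
      (mk_tree_level_lt_le hlam hW hlev δ'))) (max γ δ')
  refine ⟨β, (le_max_left _ _).trans_lt hβ, ?_, fun t ht => ⟨f t, hfA t, hf t, ?_⟩⟩
  · rw [hβs]
    rintro _ ⟨a, ha, rfl⟩
    exact ⟨(ha.2.trans ((le_max_right _ _).trans_lt hβ)).le, a, ha.1, rfl⟩
  · rw [hβs]
    exact ⟨f t, ⟨hfA t, (hδ ⟨t, ht.trans_lt hε, rfl⟩).trans_lt hδ'⟩, rfl⟩

/-- If the guess at `β`, the successor of `γ` in `c`, catches elements of `A`, then so does the
branch along `c`, grafted by the treated node. -/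
theorem IsCoherent.exists_cut_branch_eq (hD : D.IsCoherent)
    (hcode : ∀ ε, Set.InjOn (D.code (nodesBelow D.level ε)) (nodesBelow D.level ε))
    {A : Set D.Tree} {c : Set W} (hb : D.IsBranch c) {β γ : W}
    (hγ : IsGreatest (c ∩ Set.Iio β) γ) {p : W × (W → Bool)} (hp : p.2 ∈ D.level p.1)
    (hpγ : p.1 < γ) (htr : D.Treats D.level c γ p) (hcat : Catches A γ β) :
    ∃ a ∈ A, a.level ≤ β ∧ cut (graft p.2 p.1 (D.branch D.level c β)) a.level = a.seq := by
  have hγβ : γ < β := hγ.1.2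
  obtain ⟨hbγ, -⟩ := hb γ hγ.1.1
  have hz := graft_mem_level hp hbγ hpγ.le
  obtain ⟨a, haA, hcomp, hag⟩ := hcat.2 ⟨γ, _, hz⟩ le_rfl
  have haβ : a.level ≤ β := (hcat.1 _ hag).1
  -- The node `a` is comparable with the graft of `p` onto the branch at `γ`; extending the larger
  -- of the two to level `β` gives a node above both.
  obtain ⟨z', hz', hzγ, hza⟩ : ∃ z' ∈ D.level β,
      cut z' γ = graft p.2 p.1 (D.branch D.level c γ) ∧ cut z' a.level = a.seq := by
    rcases hcomp with hle | hle
    · obtain ⟨z', hz', hcut⟩ := hD.exists_extension haβ a.mem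
      refine ⟨z', hz', ?_, hcut⟩
      rw [← cut_cut_of_le hle.1, hcut]
      exact hle.2
    · obtain ⟨z', hz', hcut⟩ := hD.exists_extension hγβ.le hz
      refine ⟨z', hz', hcut, ?_⟩
      rw [← cut_cut_of_le hle.1, hcut]
      exact hle.2
  -- Putting the branch's own node below `γ` turns `z'` into an extension of the branch, and
  -- grafting `p` onto it recovers `z'`.
  have hseal : D.Seals D.level c γ (D.branch D.level c γ) β
      (graft (D.branch D.level c γ) γ z') := by
    refine ⟨⟨graft_mem_level hbγ hz' hγβ.le, ?_⟩, p, htr, _, hag, haβ, ?_⟩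
    · rw [cut_graft_of_le le_rfl, cut_self_of_mem_level hbγ]
    · rw [graft_graft_of_ge hpγ.le, graft_eq_of_cut_eq hzγ, hza]
  -- The extension chosen by `next` may seal with another element of the guess, but only for the
  -- same treated node.
  obtain ⟨-, q, hq, a', ha', ha'β, hcut⟩ := next_seals ⟨_, hseal⟩
  obtain rfl := htr.eq hcode hq
  obtain ⟨-, a'', ha'', rfl⟩ := hcat.1 a' ha'
  refine ⟨a'', ha'', ha'β, ?_⟩
  rwa [branch_eq, branchRule_of_isGreatest hγ]

/-- At the level `α` supplied by `hsq`, every node is the graft of some `x` onto a canonical branch,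
and the step treating `x` puts an element of `A` of level below `α` under it. An element of `A` at
or above level `α` would then be comparable with a different element of `A`. -/
theorem IsCoherent.exists_level_bound [NoMaxOrder W] (hD : D.IsCoherent)
    {lam : Cardinal.{u}} (hlam : ℵ₀ ≤ lam)
    (hW : ∀ α : W, #(Set.Iio α) ≤ lam) (hbdd : ∀ s : Set W, #s ≤ lam → BddAbove s)
    (hlev : ∀ α, #(D.level α) ≤ lam)
    (hcode : ∀ ε, Set.InjOn (D.code (nodesBelow D.level ε)) (nodesBelow D.level ε))
    (hbook : ∀ j < lam.ord, ∀ k : L, ∃ i, j ≤ i ∧ i < lam.ord ∧ D.book i = (j, k))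
    (hguess : ∀ s : Set (W × (W → Bool)), (∀ p ∈ s, cut p.2 p.1 = p.2) → #s ≤ lam →
      ∀ ξ, ∃ β > ξ, D.guess β = s)
    (hsq : ∀ A : Set W, IsCofinal A → ∃ α, Order.IsSuccLimit α ∧ ¬ SmallCof D.bound α ∧
      ∀ c ∈ D.club α, nacc c ⊆ A ∧ otp c = lam.ord)
    {A : Set D.Tree} (hanti : IsAntichain (· ≤ ·) A) (hA : ∀ t, ∃ a ∈ A, t ≤ a ∨ a ≤ t) :
    ∃ α, ∀ a ∈ A, a.level < α := by
  choose n hn hcat using exists_catches hlam hW hbdd hlev hguess hA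
  obtain ⟨u, g, hu, hug, hg⟩ := exists_strictMono_iterate hW hbdd hn
  -- The values of `u` are spaced so that the guess at `u ξ` catches `A` for all levels up to `g ξ`,
  -- in particular for the predecessor of `u ξ` in `c`.
  obtain ⟨α, hα, hsmall, hclub⟩ := hsq (Set.range u) fun ξ => ⟨u ξ, ⟨ξ, rfl⟩, hu.le_apply⟩
  refine ⟨α, fun t ht => ?_⟩
  by_contra! hαt
  obtain ⟨-, -, hcase⟩ := mem_level_iff.1 (cut_mem_level t.mem hαt)
  obtain ⟨δ, hδ, x, hx, c, hc, hcut⟩ := hcase.resolve_left hsmall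
  have hcα := hD.isClubIn α hα c hc
  have hb := hD.isBranch hα hc
  obtain ⟨hnacc, hotp⟩ := hclub c hc
  obtain ⟨ε, hε, hδε, -⟩ := hcα.exists_gt hα hδ
  obtain ⟨γ, hγ, hδγ, htr⟩ := exists_treats hbook hotp (p := (δ, x)) hx hε hδε
  have hne : {β ∈ c | γ < β}.Nonempty := by
    obtain ⟨β, hβ, hγβ, -⟩ := hcα.exists_gt hα (hcα.1 hγ)
    exact ⟨β, hβ, hγβ⟩
  obtain ⟨β, ⟨hβ, hγβ⟩, hmin⟩ := wellFounded_lt.has_min _ hne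
  have hβα : β < α := hcα.1 hβ
  have hgr : IsGreatest (c ∩ Set.Iio β) γ :=
    ⟨⟨hγ, hγβ⟩, fun η hη => not_lt.1 fun h => hmin η ⟨hη.1, h⟩ hη.2⟩
  obtain ⟨ξ, rfl⟩ := hnacc (mem_nacc_of_isGreatest hβ hgr)
  have hγg : γ ≤ g ξ := le_of_nacc_subset_range hu hg hnacc hγ hγβ
  have hcat' : Catches A γ (u ξ) := by
    rw [hug]
    exact ⟨(hcat (g ξ)).1, fun t ht => (hcat (g ξ)).2 t (ht.trans hγg)⟩
  obtain ⟨a, ha, haβ, hcuta⟩ := hD.exists_cut_branch_eq hcode hb hgr (p := (δ, x)) hx hδγ htr hcat'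
  have haα : a.level < α := haβ.trans_lt hβα
  have hle : a ≤ t := by
    refine ⟨haα.le.trans hαt, ?_⟩
    rw [← cut_cut_of_le haα.le, hcut, ← cut_cut_of_le haβ,
      cut_graft_of_ge (hδγ.trans hγβ).le, hb.cut_glue hβ hβα, hcuta]
  rw [hanti.eq ha ht hle] at haα
  exact haα.not_ge hαt

end Plan

end Antichains

/-! ### Enumerations -/

section Enumerations

/-- Embed `Y × X` into `X`, invert, and project to `Y`. -/
theorem exists_map_mk_preimage {X Y : Type u} [Infinite X] [Nonempty Y] (h : #Y ≤ #X) :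
    ∃ f : X → Y, ∀ y, #X ≤ #(f ⁻¹' {y}) := by
  have hle : #(Y × X) ≤ #X := by
    rw [Cardinal.mk_prod, Cardinal.lift_id, Cardinal.lift_id]
    exact (mul_le_mul' h le_rfl).trans (Cardinal.mul_eq_self (Cardinal.aleph0_le_mk X)).le
  obtain ⟨e⟩ : Nonempty (Y × X ↪ X) := hle
  obtain ⟨g, hg⟩ := e.injective.hasLeftInverse
  refine ⟨fun x => (g x).1, fun y => ?_⟩
  refine Cardinal.mk_le_of_injective (f := fun x => ⟨e (y, x), ?_⟩) fun x x' hxx' => ?_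
  · simp [hg (y, x)]
  · simpa using congrArg Subtype.val hxx'

theorem exists_code (N : Type u) {L : Type u} [Nonempty L] :
    ∃ code : Set N → N → L, ∀ s : Set N, #s ≤ #L → Set.InjOn (code s) s := by
  have key : ∀ s : Set N, ∃ f : N → L, #s ≤ #L → Set.InjOn f s := by
    intro s
    by_cases hs : #s ≤ #L
    · obtain ⟨e⟩ : Nonempty (s ↪ L) := hs
      classical
      refine ⟨fun x => if h : x ∈ s then e ⟨x, h⟩ else Classical.arbitrary L,
        fun _ x hx y hy hxy => ?_⟩
      simpa [hx, hy] using hxy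
    · exact ⟨fun _ => Classical.arbitrary L, fun h => (hs h).elim⟩
  exact ⟨fun s => (key s).choose, fun s => (key s).choose_spec⟩

theorem exists_book {lam : Cardinal.{u}} (hlam : ℵ₀ ≤ lam) :
    ∃ book : Ordinal.{u} → Ordinal.{u} × lam.ord.ToType,
      ∀ j < lam.ord, ∀ k, ∃ i, j ≤ i ∧ i < lam.ord ∧ book i = (j, k) := by
  classical
  have hL : #lam.ord.ToType = lam := Cardinal.mk_ord_toType lam
  have : Infinite lam.ord.ToType := Cardinal.infinite_iff.2 (hlam.trans_eq hL.symm)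
  obtain ⟨f, hf⟩ := exists_map_mk_preimage (X := lam.ord.ToType)
    (Y := lam.ord.ToType × lam.ord.ToType) (by
      rw [Cardinal.mk_prod, Cardinal.lift_id, hL, Cardinal.mul_eq_self hlam])
  let m : Set.Iio lam.ord ≃o lam.ord.ToType := Ordinal.ToType.mk
  refine ⟨fun o => if h : o < lam.ord then ((m.symm (f (m ⟨o, h⟩)).1).1, (f (m ⟨o, h⟩)).2)
    else (0, Classical.arbitrary _), fun j hj k => ?_⟩
  -- A fibre of size `lam` does not fit into a proper initial segment, so it has an element at or
  -- beyond `j`.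
  obtain ⟨i, hi, hji⟩ : ∃ i ∈ f ⁻¹' {(m ⟨j, hj⟩, k)}, m ⟨j, hj⟩ ≤ i := by
    by_contra! h
    have hsub : f ⁻¹' {(m ⟨j, hj⟩, k)} ⊆ Set.Iio (m ⟨j, hj⟩) := h
    have hlt := Cardinal.mk_Iio_lt (m ⟨j, hj⟩) (by simp)
    exact ((hf _).trans (Cardinal.mk_le_mk_of_subset hsub)).not_gt hlt
  refine ⟨(m.symm i).1, ?_, (m.symm i).2, ?_⟩
  · exact m.le_symm_apply.2 hji
  · have hi' : f i = (m ⟨j, hj⟩, k) := hi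
    have hlt : (m.symm i).1 < lam.ord := (m.symm i).2
    have hm : m ⟨(m.symm i).1, hlt⟩ = i := m.apply_symm_apply i
    refine (dif_pos hlt).trans ?_
    rw [hm, hi', m.symm_apply_apply]

/-- There are at most `λ⁺ · 2 ^ λ = λ⁺` bounded sequences and `(λ⁺) ^ λ = 2 ^ λ = λ⁺` small sets of
them. Listing each of these sets `λ⁺` times makes it occur cofinally often. -/
theorem exists_guess {lam : Cardinal.{u}} (hlam : ℵ₀ ≤ lam) (hCH : CH lam) {W : Type u}
    [LinearOrder W] [NoMaxOrder W] (hW : #W = Order.succ lam)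
    (hI : ∀ α : W, #(Set.Iio α) ≤ lam) :
    ∃ guess : W → Set (W × (W → Bool)), ∀ s : Set (W × (W → Bool)),
      (∀ p ∈ s, cut p.2 p.1 = p.2) → #s ≤ lam → ∀ ξ, ∃ β > ξ, guess β = s := by
  have hsucc : ℵ₀ ≤ Order.succ lam := hlam.trans (Order.le_succ lam)
  have : Infinite W := Cardinal.infinite_iff.2 (hW ▸ hsucc)
  let N : Set (W × (W → Bool)) := {p | cut p.2 p.1 = p.2}
  have hN : #N ≤ Order.succ lam := by
    let F : N → Σ α : W, (Set.Iio α → Bool) := fun p => ⟨p.1.1, fun ξ => p.1.2 ξ⟩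
    have hF : Function.Injective F := by
      rintro ⟨⟨α, x⟩, hx⟩ ⟨⟨β, y⟩, hy⟩ h
      obtain ⟨rfl, h₂⟩ := Sigma.mk.inj h
      have hxy : ∀ ξ < α, x ξ = y ξ := fun ξ hξ => congrFun (eq_of_heq h₂) ⟨ξ, hξ⟩
      refine Subtype.ext (Prod.ext rfl ?_)
      change x = y
      rw [← show cut x α = x from hx, ← show cut y α = y from hy]
      exact cut_eq_cut_iff.2 hxy
    refine (Cardinal.mk_le_of_injective hF).trans (mk_sigma_le hsucc hW.le fun α => ?_)
    rw [← hCH]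
    simpa using Cardinal.power_le_power_left two_ne_zero (hI α)
  let Y := {t : Set (W × (W → Bool)) // t ⊆ N ∧ #t ≤ lam}
  have hY : #Y ≤ #W := by
    refine (Cardinal.mk_bounded_subset_le N lam).trans ?_
    rw [hW]
    calc max #N ℵ₀ ^ lam ≤ (Order.succ lam) ^ lam :=
          Cardinal.power_le_power_right (max_le hN hsucc)
      _ = (2 ^ lam) ^ lam := by rw [show (2 : Cardinal.{u}) ^ lam = Order.succ lam from hCH]
      _ = 2 ^ lam := by rw [← Cardinal.power_mul, Cardinal.mul_eq_self hlam]
      _ ≤ Order.succ lam := hCH.le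
  have : Nonempty Y := ⟨⟨∅, Set.empty_subset _, by simp⟩⟩
  obtain ⟨f, hf⟩ := exists_map_mk_preimage hY
  refine ⟨fun β => (f β).1, fun s hs hcard ξ => ?_⟩
  by_contra! h
  obtain ⟨ζ, hζ⟩ := exists_gt ξ
  have hsub : f ⁻¹' {⟨s, hs, hcard⟩} ⊆ Set.Iio ζ := by
    intro β hβ
    refine lt_of_le_of_lt (not_lt.1 fun hlt => h β hlt ?_) hζ
    exact congrArg Subtype.val hβ
  have hle := (hf _).trans ((Cardinal.mk_le_mk_of_subset hsub).trans (hI ζ))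
  rw [hW] at hle
  exact hle.not_gt (Order.lt_succ lam)

end Enumerations

/-! ### The main construction -/

/-- A short cofinal set can be pushed into `c`, so `cof λ < κ` and `λ ^ cof λ ≤ λ`, against König's
inequality. -/
theorem not_smallCof_of_otp_eq {W : Type u} [LinearOrder W] [WellFoundedLT W]
    {lam κ : Cardinal.{u}} (hlam : ℵ₀ ≤ lam) (hκ : ∀ θ < κ, lam ^ θ ≤ lam) {c : Set W} {α : W}
    (hα : Order.IsSuccLimit α) (hc : IsClubIn c α) (hotp : otp c = lam.ord) : ¬ SmallCof κ α := by
  rintro ⟨s, hsα, hs, hcof⟩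
  have hex : ∀ η : s, ∃ γ : c, η.1 < γ.1 := fun η => by
    obtain ⟨γ, hγ, h, -⟩ := hc.exists_gt hα (hsα η.2)
    exact ⟨⟨γ, hγ⟩, h⟩
  choose f hf using hex
  have hcofinal : IsCofinal (Set.range f) := by
    intro x
    obtain ⟨η, hη, hle⟩ := hcof x.1 (hc.1 x.2)
    exact ⟨f ⟨η, hη⟩, ⟨_, rfl⟩, (hle.trans_lt (hf ⟨η, hη⟩)).le⟩
  have hle : lam.ord.cof ≤ #s := by
    have h := (Order.cof_le hcofinal).trans Cardinal.mk_range_le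
    rw [← Ordinal.cof_type] at h
    rwa [← hotp]
  exact (Cardinal.lt_power_cof_ord hlam).not_ge (hκ _ (hle.trans_lt hs))

/-- An antichain is a chain for the incomparability relation, so the maximal chain principle
applies. -/
theorem exists_maximal_antichain {T : Type u} [PartialOrder T] {B : Set T}
    (hB : IsAntichain (· ≤ ·) B) :
    ∃ A, B ⊆ A ∧ IsAntichain (· ≤ ·) A ∧ ∀ t, ∃ a ∈ A, t ≤ a ∨ a ≤ t := by
  have hchain : IsChain (fun x y : T => ¬ x ≤ y ∧ ¬ y ≤ x) B := fun x hx y hy hne =>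
    Or.inl ⟨hB hx hy hne, hB hy hx hne.symm⟩
  obtain ⟨A, hA, hBA⟩ := hchain.exists_maxChain
  refine ⟨A, hBA, fun x hx y hy hne => ?_, fun t => ?_⟩
  · exact (hA.1 hx hy hne).elim (fun h => h.1) fun h => h.2
  · by_contra! h
    have hins := hA.1.insert (a := t) fun a ha _ => Or.inl (h a ha)
    have ht : t ∈ A := hA.2 hins (Set.subset_insert t A) ▸ Set.mem_insert t A
    exact (h t ht).1 le_rfl

theorem exists_souslinTree {lam κ : Cardinal.{u}} (hlam : ℵ₀ ≤ lam)
    (hsq : ClubSquare {lam.ord} lam lam lam) (hCH : CH lam) (hκ₁ : 1 < κ) (hκ₂ : κ ≤ lam)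
    (hκ : ∀ θ < κ, lam ^ θ ≤ lam) :
    ∃ (T : Type u) (_ : PartialOrder T) (_ : IsTree T),
      IsSouslinTree T (Order.succ lam) ∧ IsHomogeneous T ∧ IsCompleteTree T κ := by
  obtain ⟨C, hC⟩ := hsq
  have hsucc : ℵ₀ ≤ Order.succ lam := hlam.trans (Order.le_succ lam)
  have hW : #(Order.succ lam).ord.ToType = Order.succ lam := Cardinal.mk_ord_toType _
  have : NoMaxOrder (Order.succ lam).ord.ToType := Cardinal.noMaxOrder hsucc
  have hI : ∀ α : (Order.succ lam).ord.ToType, #(Set.Iio α) < #(Order.succ lam).ord.ToType :=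
    fun α => Cardinal.mk_Iio_lt α (by simp)
  have hI' : ∀ α : (Order.succ lam).ord.ToType, #(Set.Iio α) ≤ lam := fun α =>
    Order.lt_succ_iff.1 ((hI α).trans_eq hW)
  have hbdd : ∀ s : Set (Order.succ lam).ord.ToType, #s ≤ lam → BddAbove s := by
    intro s hs
    refine .of_not_isCofinal fun h => ?_
    have hle := Order.cof_le h
    rw [Ordinal.cof_toType, (Cardinal.isRegular_succ hlam).cof_ord] at hle
    exact (hle.trans hs).not_gt (Order.lt_succ lam)
  have : Nonempty lam.ord.ToType := by
    rw [← Cardinal.mk_ne_zero_iff, Cardinal.mk_ord_toType]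
    exact (Cardinal.aleph0_pos.trans_le hlam).ne'
  obtain ⟨guess, hguess⟩ := exists_guess hlam hCH hW hI'
  obtain ⟨book, hbook⟩ := exists_book hlam
  obtain ⟨code, hcode⟩ := exists_code
    ((Order.succ lam).ord.ToType × ((Order.succ lam).ord.ToType → Bool)) (L := lam.ord.ToType)
  rw [Cardinal.mk_ord_toType] at hcode
  let D : Plan (Order.succ lam).ord.ToType lam.ord.ToType := ⟨C, κ, guess, code, book⟩
  have hD : D.IsCoherent := ⟨hκ₁, hC.nonempty, hC.isClubIn, hC.coherent⟩
  have hlev : ∀ α, #(D.level α) ≤ lam := D.mk_level_le hlam hI' hC.card_le hκ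
  have hseal : ∀ A : Set (Order.succ lam).ord.ToType, IsCofinal A →
      ∃ α, Order.IsSuccLimit α ∧ ¬ SmallCof κ α ∧
        ∀ c ∈ C α, nacc c ⊆ A ∧ otp c = lam.ord := by
    intro A hA
    obtain ⟨α, hα, -, hnacc, hdvd⟩ := hC.guess A hA lam.ord rfl (Cardinal.isSuccLimit_ord hlam)
    have hotp : ∀ c ∈ C α, otp c = lam.ord := by
      intro c hc
      -- A nonzero multiple of `lam.ord` that is at most `lam.ord` equals it.
      refine (hC.otp_le α c hc).antisymm (Ordinal.le_of_dvd ?_ (hdvd c hc))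
      obtain ⟨ξ, hξ⟩ := not_isMin_iff.1 hα.not_isMin
      obtain ⟨γ, hγ, -⟩ := (hC.isClubIn α hα c hc).exists_gt hα hξ
      exact (bot_le.trans_lt (otp_inter_Iio_lt hγ)).ne'
    obtain ⟨c, hc⟩ := hC.nonempty α hα
    exact ⟨α, hα, not_smallCof_of_otp_eq hlam hκ hα (hC.isClubIn α hα c hc) (hotp c hc),
      fun c hc => ⟨hnacc c hc, hotp c hc⟩⟩
  have hanti : ∀ B : Set D.Tree, #B = #(Order.succ lam).ord.ToType →
      ¬ IsAntichain (· ≤ ·) B := by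
    intro B hB hBanti
    obtain ⟨A, hBA, hA, hmax⟩ := exists_maximal_antichain hBanti
    obtain ⟨α, hα⟩ := hD.exists_level_bound hlam hI' hbdd hlev
      (fun ε => hcode _ (mk_nodesBelow_le hlam hI' fun δ _ => hlev δ)) hbook hguess hseal hA hmax
    have hle := (Cardinal.mk_le_mk_of_subset fun b hb => hα b (hBA hb)).trans
      (Plan.mk_tree_level_lt_le hlam hI' hlev α)
    rw [hB, hW] at hle
    exact hle.not_gt (Order.lt_succ lam)
  refine ⟨D.Tree, inferInstance, inferInstance, ⟨?_, fun B hB => ⟨?_, ?_⟩⟩,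
    Plan.Tree.isHomogeneous, Plan.Tree.isCompleteTree (D := D) fun s hs => ?_⟩
  · rw [Plan.Tree.treeHeight_eq hD, Ordinal.type_toType]
  · exact Plan.Tree.not_isChain_of_forall_not_isAntichain hD hI hanti (hB.trans hW.symm)
  · exact hanti B (hB.trans hW.symm)
  · obtain ⟨β, hβ⟩ := hbdd s (hs.le.trans hκ₂)
    obtain ⟨ζ, hζ⟩ := exists_gt β
    exact ⟨ζ, fun ξ hξ => (hβ hξ).trans_lt hζ⟩

end Souslin

theorem proposition43 (lam : Cardinal.{u}) (hlam : Cardinal.aleph0 < lam)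
    (hsq : Souslin.ClubSquare {lam.ord} lam lam lam) (hCH : Souslin.CH lam) :
    (∃ (T : Type u) (_ : PartialOrder T) (_ : Souslin.IsTree T),
      Souslin.IsSouslinTree T (Order.succ lam) ∧ Souslin.IsHomogeneous T) ∧
    ∃ κ : Cardinal.{u}, IsLeast {θ : Cardinal.{u} | θ ≠ 0 ∧ lam ^ θ ≠ lam} κ ∧
      ∃ (T : Type u) (_ : PartialOrder T) (_ : Souslin.IsTree T),
        Souslin.IsSouslinTree T (Order.succ lam) ∧ Souslin.IsHomogeneous T ∧
          Souslin.IsCompleteTree T κ := by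
  -- Since `lam ^ lam = 2 ^ lam > lam`, the least such cardinal `κ` exists and is at most `lam`.
  have hmem : lam ∈ {θ : Cardinal.{u} | θ ≠ 0 ∧ lam ^ θ ≠ lam} := by
    refine ⟨(Cardinal.aleph0_pos.trans hlam).ne', ?_⟩
    rw [Cardinal.power_self_eq hlam.le]
    exact (Cardinal.cantor lam).ne'
  obtain ⟨κ, hκ⟩ : ∃ κ, IsLeast {θ : Cardinal.{u} | θ ≠ 0 ∧ lam ^ θ ≠ lam} κ :=
    ⟨_, csInf_mem ⟨lam, hmem⟩, fun θ hθ => csInf_le' hθ⟩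
  have hpow : ∀ θ < κ, lam ^ θ ≤ lam := by
    intro θ hθ
    by_cases h₀ : θ = 0
    · rw [h₀, Cardinal.power_zero]
      exact Cardinal.one_lt_aleph0.le.trans hlam.le
    · by_contra h
      exact hθ.not_ge (hκ.2 ⟨h₀, fun he => h he.le⟩)
  have hκ₁ : 1 < κ := by
    refine lt_of_le_of_ne (Cardinal.one_le_iff_ne_zero.2 hκ.1.1) fun h => hκ.1.2 ?_
    rw [← h, Cardinal.power_one]
  obtain ⟨T, hT₁, hT₂, hS, hH, hK⟩ :=
    Souslin.exists_souslinTree hlam.le hsq hCH hκ₁ (hκ.2 hmem) hpow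
  exact ⟨⟨T, hT₁, hT₂, hS, hH⟩, κ, hκ, T, hT₁, hT₂, hS, hH, hK⟩
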